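/- For a finite undirected graph $G=(V,E)$ write $N(i)$ for the set of neighbours of $i$. Let $\mathrm{minrk}_2(G)$ be the minimum rank over $\mathbb{F}_2$ of a matrix $M\in\mathbb{F}_2^{V\times V}$ with $M_{i,i}\neq 0$ for all $i$ and $M_{i,j}=0$ for all distinct non-adjacent $i,j$. Consider a set $S\subseteq V$ of senders and linear maps $E^{(j)}:\mathbb{F}_2^{N(j)}\to\mathbb{F}_2^{\ell_j}$ ($j\in S$), of total length $\sum_{j\in S}\ell_j$. They form a linear embedded index code for $G$ if for every $i\in V$ there is a linear map $D^{(i)}$ with $D^{(i)}\big((E^{(j)}(x|_{N(j)}))_{j\in S},x|_{N(i)}\big)=x_i$ for all $x\in\mathbb{F}_2^V$; they form a linear task-based embedded index code if for every $i\in V$ there are a single sender $j_i\in S$ and a linear map $D^{(i)}$ with $D^{(i)}\big(E^{(j_i)}(x|_{N(j_i)}),x|_{N(i)}\big)=x_i$ for all $x\in\mathbb{F}_2^V$. Let $\mathrm{emb}(G)$ and $\mathrm{tb}(G)$ be the minimum total lengths of a linear embedded, respectively linear task-based embedded, index code for $G$ (when such codes exist). Let $G_k$ be Peeters' graph: its vertices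 are the pairs $(u,v)\in\mathbb{F}_2^k\times\mathbb{F}_2^k$ with $\langle u,v\rangle=1$, and $(u_1,v_1)$, $(u_2,v_2)$ are adjacent if and only if $\langle u_1,v_2\rangle=\langle v_1,u_2\rangle=0$. **Theorem.** There are absolute constants $c,C>0$ such that the following hold. 1. For every integer $k\ge 0$ there is a finite graph $G$, which for $k\ge 2$ can be taken to be the complement $\overline{G_k}$ of $G_k$, such that $\mathrm{minrk}_2(G)=k$, linear task-based embedded index codes for $G$ exist, and $c\,k^2\le \mathrm{tb}(G)\le C\,k^2$. Moreover, $\mathrm{emb}(G)\le 2k$ and $\mathrm{tb}(G)\ge c\cdot\mathrm{emb}(G)^2$. 2. (The gap is tight.) Every finite graph $G$ without isolated vertices has a linear task-based embedded index code, and satisfies $\mathrm{tb}(G)\le C\cdot\mathrm{minrk}_2(G)^2$ and $\mathrm{tb}(G)\le C\cdot\mathrm{emb}(G)^2$. -/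

import Mathlib

namespace IndexCoding

/-- A matrix over the binary field represents the (undirected) graph `G` if its diagonal entries
are nonzero and its entries at distinct non-adjacent pairs vanish. -/
def Represents {V : Type*} (G : SimpleGraph V) (M : Matrix V V (ZMod 2)) : Prop :=
  (∀ i, M i i ≠ 0) ∧ ∀ i j, i ≠ j → ¬ G.Adj i j → M i j = 0

/-- The minrank of `G` over the binary field. -/
noncomputable def minrk {V : Type*} [Fintype V] (G : SimpleGraph V) : ℕ :=
  sInf {r : ℕ | ∃ M : Matrix V V (ZMod 2), Represents G M ∧ M.rank = r}

/-- The minimum defining `minrk` is over a nonempty set. -/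
theorem minrk_set_nonempty {V : Type*} [Fintype V] (G : SimpleGraph V) :
    {r : ℕ | ∃ M : Matrix V V (ZMod 2), Represents G M ∧ M.rank = r}.Nonempty := by
  classical
  refine ⟨_, (1 : Matrix V V (ZMod 2)), ⟨fun i => ?_, fun i j h _ => ?_⟩, rfl⟩
  · simp
  · simp [h]

/-- A set `S` of senders, where the sender `j ∈ S` broadcasts `len j` bits that depend linearly
on the bits known to it, i.e. on the restriction of the message to its neighborhood. -/
structure LinearSenders {V : Type*} (G : SimpleGraph V) where
  /-- the receivers that act as senders -/
  S : Finset V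
  /-- the number of bits that each sender broadcasts -/
  len : S → ℕ
  /-- the linear encoding functions -/
  enc : ∀ j : S, (G.neighborSet (j : V) → ZMod 2) →ₗ[ZMod 2] (Fin (len j) → ZMod 2)

/-- The total number of broadcast bits. -/
def LinearSenders.length {V : Type*} {G : SimpleGraph V} (E : LinearSenders G) : ℕ :=
  ∑ j, E.len j

/-- The restriction of the message `x` to the bits known to the vertex `i`. -/
def sideInfo {V : Type*} (G : SimpleGraph V) (i : V) (x : V → ZMod 2) :
    G.neighborSet i → ZMod 2 :=
  fun m => x m

/-- `E` is a linear embedded index code: every receiver `i` retrieves its bit linearly from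
the whole broadcast information and its side information. -/
def LinearSenders.IsEmbeddedIndexCode {V : Type*} {G : SimpleGraph V}
    (E : LinearSenders G) : Prop :=
  ∃ D : ∀ i : V, ((∀ j : E.S, Fin (E.len j) → ZMod 2) × (G.neighborSet i → ZMod 2))
      →ₗ[ZMod 2] ZMod 2,
    ∀ (x : V → ZMod 2) (i : V),
      D i (fun j => E.enc j (sideInfo G j x), sideInfo G i x) = x i

/-- `E` is a linear task-based embedded index code: every receiver `i` retrieves its bit linearly
from the information broadcast by a single sender `s i` and its side information. -/
def LinearSenders.IsTaskBasedIndexCode {V : Type*} {G : SimpleGraph V}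
    (E : LinearSenders G) : Prop :=
  ∃ (s : V → E.S)
    (D : ∀ i : V, ((Fin (E.len (s i)) → ZMod 2) × (G.neighborSet i → ZMod 2))
      →ₗ[ZMod 2] ZMod 2),
    ∀ (x : V → ZMod 2) (i : V),
      D i (E.enc (s i) (sideInfo G (s i) x), sideInfo G i x) = x i

/-- The lengths of the linear embedded index codes for `G`. -/
def embeddedLengths {V : Type*} (G : SimpleGraph V) : Set ℕ :=
  {l | ∃ E : LinearSenders G, E.IsEmbeddedIndexCode ∧ E.length = l}

/-- The lengths of the linear task-based embedded index codes for `G`. -/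
def taskBasedLengths {V : Type*} (G : SimpleGraph V) : Set ℕ :=
  {l | ∃ E : LinearSenders G, E.IsTaskBasedIndexCode ∧ E.length = l}

/-- The minimum length of a linear embedded index code for `G`
(meaningful when `embeddedLengths G` is nonempty). -/
noncomputable def emb {V : Type*} (G : SimpleGraph V) : ℕ := sInf (embeddedLengths G)

/-- The minimum length of a linear task-based embedded index code for `G`
(meaningful when `taskBasedLengths G` is nonempty). -/
noncomputable def tb {V : Type*} (G : SimpleGraph V) : ℕ := sInf (taskBasedLengths G)

/-- The pairs of binary vectors of length `k` with inner product `1`. -/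
abbrev PeetersVertex (k : ℕ) : Type :=
  {p : (Fin k → ZMod 2) × (Fin k → ZMod 2) // p.1 ⬝ᵥ p.2 = 1}

/-- Peeters' graph `G_k`. -/
def peetersGraph (k : ℕ) : SimpleGraph (PeetersVertex k) where
  Adj p q := p.1.1 ⬝ᵥ q.1.2 = 0 ∧ p.1.2 ⬝ᵥ q.1.1 = 0
  symm := ⟨fun p q h => ⟨by rw [dotProduct_comm]; exact h.2, by rw [dotProduct_comm]; exact h.1⟩⟩
  loopless := ⟨fun p h => by
    have h1 := p.2
    rw [h.1] at h1
    exact zero_ne_one h1⟩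

end IndexCoding

/-!
Let `r = minrk G`, attained by a matrix `M`.

For upper bounds, take `r` rows of `M` spanning all rows. No column of `M` vanishes, so the vertices
indexing these rows, together with one neighbor of each, meet every neighborhood when `G` has no
isolated vertices. If each of these at most `2 * r` vertices sends the product of `M` with its part
of the message, in the `r` coordinates of the spanning rows, then every vertex is served by any
neighbor among them, so `tb G ≤ 2 * r ^ 2` (`tb_le_two_mul_minrk_sq`). Sending instead each of the
`r` row functionals once, split between the vertex of that row and one of its neighbors, gives
`emb G ≤ 2 * r` (`emb_le_two_mul_minrk`). As any linear code yields a representing matrix, also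
`r ≤ emb G` (`minrk_le_emb`). These bounds hold for all graphs without
isolated vertices; the minrank of the complement of Peeters' graph is `k` because the matrix of inner
products has rank at most `k` and the pairs of equal unit vectors are pairwise non-adjacent.

For the lower bound on the complement of Peeters' graph, consider a task-based code of length `T`.
Give each vertex the colour consisting of its sender and of the functional of the sender's bits that
it uses. A colour class is independent in Peeters' graph (`exists_colour`), hence by a character sum
estimate it has at most `3 * 2 ^ (3 * k / 2)` elements (`card_sq_le_of_independent`). A sender
serves only its neighbors. If `T` is less than a small multiple of `k ^ 2`, fewer than `k / 16`
senders use more than `k / 8` bits, and the vertices orthogonal to all of them, at least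
`2 ^ (2 * k - k / 8 - 2)` in number, are coloured by the remaining senders, which provide at most
`T * 2 ^ (k / 8)` colours. Comparing the two counts makes `T` exponential in `k`
(`two_pow_le_of_taskBased`), so that `T` is at least of order `k ^ 2` in either case
(`sq_le_length_of_taskBased`).
-/

namespace IndexCoding

/-! ### Matrices representing a graph -/

theorem exists_represents_rank_eq_minrk {V : Type*} [Fintype V] (G : SimpleGraph V) :
    ∃ M : Matrix V V (ZMod 2), Represents G M ∧ M.rank = minrk G :=
  Nat.sInf_mem (minrk_set_nonempty G)

theorem Represents.minrk_le {V : Type*} [Fintype V] {G : SimpleGraph V}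
    {M : Matrix V V (ZMod 2)} (hM : Represents G M) : minrk G ≤ M.rank :=
  Nat.sInf_le ⟨M, hM, rfl⟩

theorem zmod_two_eq_one {a : ZMod 2} (h : a ≠ 0) : a = 1 := by
  revert a; decide

theorem minrk_le_of_dotProduct {V : Type*} [Fintype V] (G : SimpleGraph V) {k : ℕ}
    (u v : V → Fin k → ZMod 2) (hdiag : ∀ i, u i ⬝ᵥ v i = 1)
    (hoff : ∀ i j, i ≠ j → ¬ G.Adj i j → u i ⬝ᵥ v j = 0) : minrk G ≤ k := by
  have hM : Represents G (Matrix.of u * (Matrix.of v).transpose) := by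
    refine ⟨fun i => ?_, fun i j hij hadj => hoff i j hij hadj⟩
    have h : (Matrix.of u * (Matrix.of v).transpose) i i = 1 := hdiag i
    rw [h]
    exact one_ne_zero
  calc minrk G ≤ _ := hM.minrk_le
    _ ≤ (Matrix.of u).rank := Matrix.rank_mul_le_left _ _
    _ ≤ k := by simpa using (Matrix.of u).rank_le_card_width

theorem le_minrk_of_pairwise_not_adj {V : Type*} [Fintype V] (G : SimpleGraph V) {k : ℕ}
    (f : Fin k → V) (hf : ∀ s t, s ≠ t → f s ≠ f t ∧ ¬ G.Adj (f s) (f t)) : k ≤ minrk G := by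
  obtain ⟨M, hM, hr⟩ := exists_represents_rank_eq_minrk G
  have hone : M.submatrix f f = 1 := by
    ext s t
    by_cases h : s = t
    · subst h
      simp [zmod_two_eq_one (hM.1 (f s))]
    · simpa [h] using hM.2 _ _ (hf s t h).1 (hf s t h).2
  have h := M.rank_submatrix_le f f
  rw [hone, Matrix.rank_one, Fintype.card_fin, hr] at h
  exact h

/-- Some `M.rank` rows of a matrix span all its rows. -/
theorem exists_rows_spanning {V : Type*} [Fintype V] (M : Matrix V V (ZMod 2)) :
    ∃ (r : Fin M.rank → V) (A : Matrix V (Fin M.rank) (ZMod 2)), M = A * M.submatrix r id := by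
  have hrank := M.rank_eq_finrank_span_row
  obtain ⟨f, hf, hspan, -⟩ :=
    Submodule.exists_fun_fin_finrank_span_eq (ZMod 2) (Set.range M.row)
  choose r hr using hf
  have hmem : ∀ v, ∃ c : _ → ZMod 2, ∑ t, c t • f t = M.row v := fun v => by
    rw [← Submodule.mem_span_range_iff_exists_fun, hspan]
    exact Submodule.subset_span ⟨v, rfl⟩
  choose c hc using hmem
  refine ⟨fun t => r (finCongr hrank t), Matrix.of fun v t => c v (finCongr hrank t), ?_⟩
  ext v q
  have h := congr_fun (hc v) q
  rw [Finset.sum_apply, ← Equiv.sum_comp (finCongr hrank)] at h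
  refine h.symm.trans (Finset.sum_congr rfl fun t _ => ?_)
  rw [← hr]
  rfl

/-- The part of the `i`-th coordinate of `M *ᵥ x` that the vertex `i` knows. -/
noncomputable def knownPart {V : Type*} [Fintype V] (G : SimpleGraph V) (M : Matrix V V (ZMod 2))
    (i : V) : (G.neighborSet i → ZMod 2) →ₗ[ZMod 2] ZMod 2 :=
  open scoped Classical in
  ∑ m : G.neighborSet i, M i m • LinearMap.proj m

theorem Represents.mulVec_apply {V : Type*} [Fintype V] {G : SimpleGraph V}
    {M : Matrix V V (ZMod 2)} (hM : Represents G M) (x : V → ZMod 2) (i : V) :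
    (M.mulVec x) i = x i + knownPart G M i (sideInfo G i x) := by
  classical
  have hnb : ∑ m : G.neighborSet i, M i m * x m = ∑ m, if G.Adj i m then M i m * x m else 0 := by
    rw [← Finset.sum_filter]
    exact (Finset.sum_subtype (p := fun m => m ∈ G.neighborSet i) _ (by simp)
      fun m => M i m * x m).symm
  have hk : knownPart G M i (sideInfo G i x) = ∑ m : G.neighborSet i, M i m * x m := by
    simp only [knownPart, LinearMap.sum_apply, LinearMap.smul_apply, LinearMap.proj_apply,
      sideInfo, smul_eq_mul]
  have hx : x i = ∑ m, if i = m then M i m * x m else 0 := by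
    simp [zmod_two_eq_one (hM.1 i)]
  rw [hk, hnb, hx, ← Finset.sum_add_distrib]
  refine Finset.sum_congr rfl fun m _ => ?_
  by_cases h : i = m
  · subst h
    simp
  · by_cases h' : G.Adj i m
    · simp [h, h']
    · simp [h, h', hM.2 i m h h']

/-! ### Comparing the two code lengths and the minrank -/

theorem LinearSenders.IsTaskBasedIndexCode.isEmbeddedIndexCode {V : Type*} {G : SimpleGraph V}
    {E : LinearSenders G} (h : E.IsTaskBasedIndexCode) : E.IsEmbeddedIndexCode := by
  obtain ⟨s, D, hD⟩ := h
  exact ⟨fun i => D i ∘ₗ (LinearMap.proj (s i)).prodMap LinearMap.id, fun x i => hD x i⟩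

theorem LinearSenders.IsEmbeddedIndexCode.minrk_le {V : Type*} [Fintype V] {G : SimpleGraph V}
    {E : LinearSenders G} (h : E.IsEmbeddedIndexCode) : minrk G ≤ E.length := by
  classical
  obtain ⟨D, hD⟩ := h
  let enc : (V → ZMod 2) →ₗ[ZMod 2] (∀ j : E.S, Fin (E.len j) → ZMod 2) :=
    LinearMap.pi fun j => E.enc j ∘ₗ LinearMap.funLeft (ZMod 2) (ZMod 2) Subtype.val
  let dec : (∀ j : E.S, Fin (E.len j) → ZMod 2) →ₗ[ZMod 2] (V → ZMod 2) :=
    LinearMap.pi fun i => D i ∘ₗ LinearMap.inl _ _ _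
  have hentry : ∀ i m, ¬ G.Adj i m →
      LinearMap.toMatrix' (dec ∘ₗ enc) i m = (Pi.single m 1 : V → ZMod 2) i := by
    intro i m hadj
    have hside : sideInfo G i (Pi.single m 1) = 0 := by
      funext q
      have hq : (q : V) ≠ m := fun h => hadj (h ▸ q.2)
      simp [sideInfo, hq]
    rw [← hD (Pi.single m 1) i, hside, LinearMap.toMatrix'_apply]
    rfl
  have hM : Represents G (LinearMap.toMatrix' (dec ∘ₗ enc)) := by
    refine ⟨fun i => ?_, fun i m him hadj => ?_⟩
    · rw [hentry i i G.irrefl]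
      simp
    · rw [hentry i m hadj]
      simp [him]
  refine hM.minrk_le.trans ?_
  have hlen : Module.finrank (ZMod 2) (∀ j : E.S, Fin (E.len j) → ZMod 2) = E.length := by
    simp [Module.finrank_pi_fintype, LinearSenders.length]
  rw [Matrix.rank, ← Matrix.toLin'_apply', Matrix.toLin'_toMatrix', ← hlen]
  exact (Submodule.finrank_mono (LinearMap.range_comp_le_range enc dec)).trans
    (LinearMap.finrank_range_le dec)

theorem minrk_le_emb {V : Type*} [Fintype V] (G : SimpleGraph V)
    (h : (embeddedLengths G).Nonempty) : minrk G ≤ emb G := by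
  obtain ⟨E, hE, hl⟩ := Nat.sInf_mem h
  exact hE.minrk_le.trans hl.le

theorem emb_le_tb {V : Type*} (G : SimpleGraph V)
    (h : (taskBasedLengths G).Nonempty) : emb G ≤ tb G := by
  obtain ⟨E, hE, hl⟩ := Nat.sInf_mem h
  exact Nat.sInf_le ⟨E, hE.isEmbeddedIndexCode, hl⟩

/-! ### Codes for graphs without isolated vertices -/

/-- The senders obtained from a family of linear functionals, the functional `f t` being
transmitted by the vertex `s t`, which may be the same vertex for several `t`. -/
noncomputable def LinearSenders.ofFunctionals {V ι : Type*} [Fintype V] [Fintype ι]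
    {G : SimpleGraph V} (s : ι → V)
    (f : ∀ t, (G.neighborSet (s t) → ZMod 2) →ₗ[ZMod 2] ZMod 2) : LinearSenders G :=
  open scoped Classical in
  { S := Finset.univ
    len := fun j => Fintype.card {t // s t = j}
    enc := fun j => LinearMap.pi fun n =>
      let t := (Fintype.equivFin {t // s t = (j : V)}).symm n
      f t ∘ₗ LinearMap.funLeft (ZMod 2) (ZMod 2) fun m =>
        ⟨m, Eq.subst (motive := fun v => (m : V) ∈ G.neighborSet v) t.2 m.2⟩ }

theorem LinearSenders.length_ofFunctionals {V ι : Type*} [Fintype V] [Fintype ι]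
    {G : SimpleGraph V} (s : ι → V)
    (f : ∀ t, (G.neighborSet (s t) → ZMod 2) →ₗ[ZMod 2] ZMod 2) :
    (LinearSenders.ofFunctionals s f).length = Fintype.card ι := by
  classical
  rw [← Fintype.card_congr (Equiv.sigmaFiberEquiv s), Fintype.card_sigma,
    ← Finset.sum_coe_sort Finset.univ]
  refine Finset.sum_congr rfl fun j _ => ?_
  exact Fintype.card_congr (Equiv.refl {t // s t = (j : V)})

theorem LinearSenders.exists_read_ofFunctionals {V ι : Type*} [Fintype V] [Fintype ι]
    {G : SimpleGraph V} (s : ι → V)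
    (f : ∀ t, (G.neighborSet (s t) → ZMod 2) →ₗ[ZMod 2] ZMod 2) (t : ι) :
    ∃ R : (∀ j : (LinearSenders.ofFunctionals s f).S,
        Fin ((LinearSenders.ofFunctionals s f).len j) → ZMod 2) →ₗ[ZMod 2] ZMod 2,
      ∀ x, R (fun j => (LinearSenders.ofFunctionals s f).enc j (sideInfo G j x)) =
        f t (sideInfo G (s t) x) := by
  classical
  refine ⟨LinearMap.proj (Fintype.equivFin {t' // s t' = s t} ⟨t, rfl⟩) ∘ₗ
    LinearMap.proj ⟨s t, Finset.mem_univ _⟩, fun x => ?_⟩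
  have hread : ∀ t' : {t' // s t' = s t}, t' = ⟨t, rfl⟩ →
      f t' (sideInfo G (s t') x) = f t (sideInfo G (s t) x) := fun t' ht' => by rw [ht']
  exact hread _ (Equiv.symm_apply_apply _ _)

/-- The row functionals `x ↦ (M *ᵥ x) (r t)` of a spanning set of rows of a matrix `M` of minimum
rank form an index code. The vertex `r t` knows its functional except for the summand `x (r t)`,
which any neighbor of `r t` can send. -/
theorem exists_embedded_length_eq {V : Type*} [Fintype V] (G : SimpleGraph V)
    (hG : ∀ v, ∃ w, G.Adj v w) : 2 * minrk G ∈ embeddedLengths G := by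
  classical
  obtain ⟨M, hM, hr⟩ := exists_represents_rank_eq_minrk G
  obtain ⟨r, A, hA⟩ := exists_rows_spanning M
  choose w hw using hG
  let s : Fin M.rank ⊕ Fin M.rank → V := Sum.elim r (w ∘ r)
  let f : ∀ t, (G.neighborSet (s t) → ZMod 2) →ₗ[ZMod 2] ZMod 2 := fun t =>
    match t with
    | Sum.inl t => knownPart G M (r t)
    | Sum.inr t => LinearMap.proj ⟨r t, (hw (r t)).symm⟩
  choose R hR using LinearSenders.exists_read_ofFunctionals s f
  refine ⟨LinearSenders.ofFunctionals s f,
    ⟨fun i => (∑ t, A i t • (R (Sum.inr t) + R (Sum.inl t))).coprod (-knownPart G M i),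
      fun x i => ?_⟩, ?_⟩
  · have hrow : ∀ t, f (Sum.inr t) (sideInfo G (s (Sum.inr t)) x) +
        f (Sum.inl t) (sideInfo G (s (Sum.inl t)) x) = (M.mulVec x) (r t) := fun t =>
      (hM.mulVec_apply x (r t)).symm
    have hcomb : ∑ t, A i t * (M.mulVec x) (r t) = (M.mulVec x) i := by
      conv_rhs => rw [hA, ← Matrix.mulVec_mulVec]
      rfl
    simp only [LinearMap.coprod_apply, LinearMap.sum_apply, LinearMap.smul_apply,
      LinearMap.add_apply, hR, hrow, smul_eq_mul, hcomb, LinearMap.neg_apply]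
    rw [hM.mulVec_apply x i]
    ring
  · rw [LinearSenders.length_ofFunctionals]
    simp [← hr, two_mul]

/-- A family of vertices in which every vertex has a neighbor, each of which sends `minrk G` bits,
suffices for a task-based code: the sender `j` broadcasts the product of a matrix `M` of minimum
rank with the part of the message known to `j`, in coordinates given by a row basis of `M`. -/
theorem exists_taskBased_length_eq {V : Type*} [Fintype V] (G : SimpleGraph V) (S : Finset V)
    (hS : ∀ v, ∃ w ∈ S, G.Adj v w) : S.card * minrk G ∈ taskBasedLengths G := by
  classical
  obtain ⟨M, hM, hr⟩ := exists_represents_rank_eq_minrk G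
  obtain ⟨r, A, hA⟩ := exists_rows_spanning M
  choose w hwS hw using hS
  let ext : ∀ j : V, (G.neighborSet j → ZMod 2) →ₗ[ZMod 2] (V → ZMod 2) := fun j =>
    { toFun := fun z v => if h : G.Adj j v then z ⟨v, h⟩ else 0
      map_add' := fun y z => by
        funext v
        by_cases h : G.Adj j v <;> simp [h]
      map_smul' := fun c z => by
        funext v
        by_cases h : G.Adj j v <;> simp [h] }
  let mask : ∀ i j : V, (G.neighborSet i → ZMod 2) →ₗ[ZMod 2] (G.neighborSet i → ZMod 2) :=
    fun i j => LinearMap.pi fun m => if G.Adj j m then LinearMap.proj m else 0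
  have hmask : ∀ i j x, sideInfo G i (ext j (sideInfo G j x)) = mask i j (sideInfo G i x) := by
    intro i j x
    funext m
    by_cases h : G.Adj j m <;> simp [ext, mask, sideInfo, h]
  let E : LinearSenders G :=
    { S := S
      len := fun _ => M.rank
      enc := fun j => (M.submatrix r id).mulVecLin ∘ₗ ext j }
  refine ⟨E, ⟨fun i => ⟨w i, hwS i⟩, fun i =>
    (LinearMap.proj i ∘ₗ A.mulVecLin).coprod (-(knownPart G M i ∘ₗ mask i (w i))),
    fun x i => ?_⟩, ?_⟩
  · have hx : ext (w i) (sideInfo G (w i) x) i = x i := by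
      simp [ext, (hw i).symm, sideInfo]
    have hcomb : A.mulVec ((M.submatrix r id).mulVec (ext (w i) (sideInfo G (w i) x))) i =
        (M.mulVec (ext (w i) (sideInfo G (w i) x))) i := by
      rw [Matrix.mulVec_mulVec, ← hA]
    rw [hM.mulVec_apply, hx, hmask] at hcomb
    simp only [E, LinearMap.coprod_apply, LinearMap.comp_apply, LinearMap.neg_apply,
      Matrix.mulVecLin_apply, LinearMap.proj_apply]
    rw [hcomb]
    ring
  · simp [LinearSenders.length, E, hr]

/-- The indices of a row basis of a representing matrix, together with a neighbor of each, meet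
every neighborhood, as no column of the matrix vanishes. -/
theorem exists_card_le_two_mul_minrk {V : Type*} [Fintype V] (G : SimpleGraph V)
    (hG : ∀ v, ∃ w, G.Adj v w) :
    ∃ S : Finset V, S.card ≤ 2 * minrk G ∧ ∀ v, ∃ w ∈ S, G.Adj v w := by
  classical
  obtain ⟨M, hM, hr⟩ := exists_represents_rank_eq_minrk G
  obtain ⟨r, A, hA⟩ := exists_rows_spanning M
  choose w hw using hG
  refine ⟨Finset.univ.image r ∪ Finset.univ.image (w ∘ r), ?_, fun v => ?_⟩
  · refine (Finset.card_union_le _ _).trans ?_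
    have h₁ := Finset.card_image_le (s := Finset.univ) (f := r)
    have h₂ := Finset.card_image_le (s := Finset.univ) (f := w ∘ r)
    simp only [Finset.card_univ, Fintype.card_fin, hr] at h₁ h₂
    omega
  · obtain ⟨t, ht⟩ : ∃ t, M (r t) v ≠ 0 := by
      by_contra! h
      refine hM.1 v ?_
      rw [hA, Matrix.mul_apply]
      exact Finset.sum_eq_zero fun t _ => by simp [h t]
    by_cases hv : r t = v
    · exact ⟨w (r t), by simp, hv ▸ hw (r t)⟩
    · refine ⟨r t, by simp, ?_⟩
      by_contra hadj
      exact ht (hM.2 _ _ hv fun h => hadj h.symm)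

theorem taskBasedLengths_nonempty {V : Type*} [Fintype V] (G : SimpleGraph V)
    (hG : ∀ v, ∃ w, G.Adj v w) : (taskBasedLengths G).Nonempty :=
  have ⟨S, _, hS⟩ := exists_card_le_two_mul_minrk G hG
  ⟨_, exists_taskBased_length_eq G S hS⟩

theorem tb_le_two_mul_minrk_sq {V : Type*} [Fintype V] (G : SimpleGraph V)
    (hG : ∀ v, ∃ w, G.Adj v w) : tb G ≤ 2 * minrk G ^ 2 := by
  obtain ⟨S, hcard, hS⟩ := exists_card_le_two_mul_minrk G hG
  calc tb G ≤ S.card * minrk G := Nat.sInf_le (exists_taskBased_length_eq G S hS)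
    _ ≤ 2 * minrk G * minrk G := Nat.mul_le_mul_right _ hcard
    _ = 2 * minrk G ^ 2 := by ring

theorem emb_le_two_mul_minrk {V : Type*} [Fintype V] (G : SimpleGraph V)
    (hG : ∀ v, ∃ w, G.Adj v w) : emb G ≤ 2 * minrk G :=
  Nat.sInf_le (exists_embedded_length_eq G hG)

/-! ### The colouring given by a task-based code -/

/-- A task-based code colours every vertex by its sender and by the nonzero functional of the
sender's bits that it uses. The sender has to know the bit in question, and two vertices of the same
colour are adjacent, since the unit vector at one of two non-adjacent vertices is decoded to
different values there while the shared functional takes only one value. -/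
theorem LinearSenders.IsTaskBasedIndexCode.exists_colour {V : Type*} {G : SimpleGraph V}
    {E : LinearSenders G} (h : E.IsTaskBasedIndexCode) :
    ∃ c : V → Σ j : E.S, (Fin (E.len j) → ZMod 2),
      (∀ i, G.Adj (c i).1 i) ∧ (∀ i, (c i).2 ≠ 0) ∧
        ∀ i m, c i = c m → i = m ∨ G.Adj i m := by
  classical
  obtain ⟨s, D, hD⟩ := h
  let a : ∀ i, Fin (E.len (s i)) → ZMod 2 := fun i t => D i (Pi.single t 1, 0)
  let val : (Σ j : E.S, (Fin (E.len j) → ZMod 2)) → (V → ZMod 2) → ZMod 2 := fun c x =>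
    E.enc c.1 (sideInfo G c.1 x) ⬝ᵥ c.2
  have hside : ∀ i m, ¬ G.Adj i m → sideInfo G i (Pi.single m 1) = 0 := by
    intro i m hadj
    funext q
    have hq : (q : V) ≠ m := fun h => hadj (h ▸ q.2)
    simp [sideInfo, hq]
  have hval : ∀ i m, ¬ G.Adj i m →
      val ⟨s i, a i⟩ (Pi.single m 1) = (Pi.single m 1 : V → ZMod 2) i := by
    intro i m hadj
    rw [← hD (Pi.single m 1) i, hside i m hadj]
    generalize hy : E.enc (s i) (sideInfo G (s i) (Pi.single m 1)) = y
    have h := LinearMap.pi_apply_eq_sum_univ (D i ∘ₗ LinearMap.inl _ _ _) y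
    simp only [LinearMap.comp_apply, LinearMap.inl_apply] at h
    rw [h]
    simp only [val, hy, dotProduct, a, smul_eq_mul]
    refine Finset.sum_congr rfl fun t _ => ?_
    congr 3
    funext q
    simp [Pi.single_apply, eq_comm]
  have hself : ∀ i, val ⟨s i, a i⟩ (Pi.single i 1) = 1 := fun i => by
    rw [hval i i G.irrefl, Pi.single_eq_same]
  refine ⟨fun i => ⟨s i, a i⟩, fun i => ?_, fun i hi => ?_, fun i m him => ?_⟩
  · by_contra hadj
    have h := hself i
    simp [val, hside _ _ hadj] at h
  · have h := hself i
    simp only [] at hi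
    simp [val, hi] at h
  · by_contra! hne
    have h := hself m
    rw [← show _ = (⟨s m, a m⟩ : Σ j : E.S, (Fin (E.len j) → ZMod 2)) from him, hval i m hne.2, Pi.single_eq_of_ne hne.1] at h
    exact zero_ne_one h

/-! ### Signs of bilinear forms -/

/-- The nontrivial additive character of the binary field. -/
def sgn (a : ZMod 2) : ℤ := if a = 0 then 1 else -1

theorem sgn_add (a b : ZMod 2) : sgn (a + b) = sgn a * sgn b := by
  revert a b; decide

theorem sum_sgn_linear {X : Type*} [AddCommGroup X] [Module (ZMod 2) X] [Fintype X]
    (f : X →ₗ[ZMod 2] ZMod 2) (hf : f ≠ 0) : ∑ x, sgn (f x) = 0 := by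
  obtain ⟨z, hz⟩ : ∃ z, f z ≠ 0 := by
    by_contra! h
    exact hf (LinearMap.ext h)
  have hneg : ∑ x, sgn (f x) = -∑ x, sgn (f x) := by
    rw [← Finset.sum_neg_distrib, ← Equiv.sum_comp (Equiv.addRight z)]
    refine Finset.sum_congr rfl fun x _ => ?_
    simp [sgn_add, show sgn (f z) = -1 from if_neg hz]
  omega

/-- Cauchy–Schwarz for a family `B` of linear functionals each of which is repeated at most `m`
times. -/
theorem sq_sum_sgn_le {X Y : Type*} [AddCommGroup X] [Module (ZMod 2) X] [Fintype X]
    [DecidableEq (X →ₗ[ZMod 2] ZMod 2)]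
    (P : Finset X) (W : Finset Y) (B : Y → X →ₗ[ZMod 2] ZMod 2) (m : ℕ)
    (hm : ∀ y, (W.filter fun y' => B y' = B y).card ≤ m) :
    (∑ x ∈ P, ∑ y ∈ W, sgn (B y x)) ^ 2 ≤ P.card * (W.card * (Fintype.card X * m)) := by
  have hpair : ∀ y y', ∑ x, sgn (B y x) * sgn (B y' x) =
      if B y' = B y then (Fintype.card X : ℤ) else 0 := by
    intro y y'
    simp only [← sgn_add, ← LinearMap.add_apply]
    split_ifs with h
    · have hzero : B y + B y' = 0 := by
        rw [h]
        ext x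
        exact CharTwo.add_self_eq_zero _
      simp [hzero, sgn]
    · refine sum_sgn_linear _ fun h' => h ?_
      ext x
      have hx := LinearMap.congr_fun h' x
      exact (CharTwo.add_eq_zero.1 hx).symm
  calc (∑ x ∈ P, ∑ y ∈ W, sgn (B y x)) ^ 2
      ≤ P.card * ∑ x ∈ P, (∑ y ∈ W, sgn (B y x)) ^ 2 := sq_sum_le_card_mul_sum_sq
    _ ≤ P.card * ∑ x, (∑ y ∈ W, sgn (B y x)) ^ 2 := by
        refine mul_le_mul_of_nonneg_left ?_ (Nat.cast_nonneg _)
        exact Finset.sum_le_univ_sum_of_nonneg fun x => sq_nonneg (∑ y ∈ W, sgn (B y x))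
    _ = P.card * ∑ y ∈ W, ∑ y' ∈ W, ∑ x, sgn (B y x) * sgn (B y' x) := by
        congr 1
        simp only [sq, Finset.sum_mul_sum]
        rw [Finset.sum_comm]
        exact Finset.sum_congr rfl fun y _ => Finset.sum_comm
    _ = P.card * ∑ y ∈ W, ((W.filter fun y' => B y' = B y).card * Fintype.card X : ℤ) := by
        simp only [hpair, ← Finset.sum_filter, Finset.sum_const, nsmul_eq_mul]
    _ ≤ P.card * ∑ _y ∈ W, (m * Fintype.card X : ℤ) := by
        gcongr with y
        exact_mod_cast hm y
    _ = P.card * (W.card * (Fintype.card X * m)) := by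
        rw [Finset.sum_const, nsmul_eq_mul]
        ring

/-! ### Independent sets of Peeters' graph -/

/-- The functional `x ↦ ⟨x, v⟩`. -/
def dotRight {k : ℕ} (v : Fin k → ZMod 2) : (Fin k → ZMod 2) →ₗ[ZMod 2] ZMod 2 where
  toFun x := x ⬝ᵥ v
  map_add' x y := add_dotProduct x y v
  map_smul' c x := smul_dotProduct c x v

@[simp]
theorem dotRight_apply {k : ℕ} (v x : Fin k → ZMod 2) : dotRight v x = x ⬝ᵥ v := rfl

theorem dotRight_injective {k : ℕ} : Function.Injective (dotRight (k := k)) := by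
  intro v w h
  funext t
  simpa using LinearMap.congr_fun h (Pi.single t 1)

/-- An independent set `W` of Peeters' graph has at most `3 * 2 ^ (3 * k / 2)` elements, whereas the
graph has about `2 ^ (2 * k - 1)` vertices: on `W × W` the product
`(1 + sgn ⟨u, v'⟩) * (1 + sgn ⟨u', v⟩)` vanishes, while each of the three character sums in its
expansion is small. -/
theorem card_sq_le_of_independent {k : ℕ} (W : Finset ((Fin k → ZMod 2) × (Fin k → ZMod 2)))
    (hW : ∀ p ∈ W, ∀ q ∈ W, ¬ (p.1 ⬝ᵥ q.2 = 0 ∧ p.2 ⬝ᵥ q.1 = 0)) :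
    W.card ^ 2 ≤ 9 * 8 ^ k := by
  classical
  have hcard : (Fintype.card ((Fin k → ZMod 2) × (Fin k → ZMod 2)) : ℤ) = 2 ^ k * 2 ^ k := by
    simp
  have hbound : ∀ B : ((Fin k → ZMod 2) × (Fin k → ZMod 2)) →
      ((Fin k → ZMod 2) × (Fin k → ZMod 2)) →ₗ[ZMod 2] ZMod 2,
      (∀ q, (W.filter fun q' => B q' = B q).card ≤ 2 ^ k) →
      (∑ p ∈ W, ∑ q ∈ W, sgn (B q p)) ^ 2 ≤ (W.card : ℤ) ^ 2 * 8 ^ k := by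
    intro B hB
    refine (sq_sum_sgn_le W W B (2 ^ k) hB).trans_eq ?_
    rw [hcard, show (8 : ℤ) = 2 * 2 * 2 by norm_num, mul_pow, mul_pow]
    push_cast
    ring
  have hfst : ∀ B : ((Fin k → ZMod 2) × (Fin k → ZMod 2)) →
      ((Fin k → ZMod 2) × (Fin k → ZMod 2)) →ₗ[ZMod 2] ZMod 2,
      (∀ q q', B q' = B q → q'.1 = q.1) → ∀ q, (W.filter fun q' => B q' = B q).card ≤ 2 ^ k := by
    intro B hB q
    have h := Finset.card_le_card_of_injOn (s := W.filter fun q' => B q' = B q)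
      (t := (Finset.univ : Finset (Fin k → ZMod 2))) Prod.snd (fun _ _ => Finset.mem_univ _) (by
        intro x hx y hy hxy
        have hx' := hB _ _ (Finset.mem_filter.1 hx).2
        have hy' := hB _ _ (Finset.mem_filter.1 hy).2
        exact Prod.ext (hx'.trans hy'.symm) hxy)
    simpa using h
  have hsnd : ∀ B : ((Fin k → ZMod 2) × (Fin k → ZMod 2)) →
      ((Fin k → ZMod 2) × (Fin k → ZMod 2)) →ₗ[ZMod 2] ZMod 2,
      (∀ q q', B q' = B q → q'.2 = q.2) → ∀ q, (W.filter fun q' => B q' = B q).card ≤ 2 ^ k := by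
    intro B hB q
    have h := Finset.card_le_card_of_injOn (s := W.filter fun q' => B q' = B q)
      (t := (Finset.univ : Finset (Fin k → ZMod 2))) Prod.fst (fun _ _ => Finset.mem_univ _) (by
        intro x hx y hy hxy
        have hx' := hB _ _ (Finset.mem_filter.1 hx).2
        have hy' := hB _ _ (Finset.mem_filter.1 hy).2
        exact Prod.ext hxy (hx'.trans hy'.symm))
    simpa using h
  have h₁ := hbound (fun q => dotRight q.2 ∘ₗ LinearMap.fst _ _ _) (hsnd _ fun q q' h =>
    dotRight_injective (LinearMap.ext fun x => by simpa using LinearMap.congr_fun h (x, 0)))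
  have h₂ := hbound (fun q => dotRight q.1 ∘ₗ LinearMap.snd _ _ _) (hfst _ fun q q' h =>
    dotRight_injective (LinearMap.ext fun x => by simpa using LinearMap.congr_fun h (0, x)))
  have h₃ := hbound (fun q => (dotRight q.2).coprod (dotRight q.1)) (hfst _ fun q q' h =>
    dotRight_injective (LinearMap.ext fun x => by simpa using LinearMap.congr_fun h (0, x)))
  simp only [LinearMap.comp_apply, LinearMap.fst_apply, LinearMap.snd_apply, dotRight_apply,
    LinearMap.coprod_apply] at h₁ h₂ h₃
  have hzero : ∀ a b : ZMod 2, ¬ (a = 0 ∧ b = 0) → 1 + sgn a + sgn b + sgn (a + b) = 0 := by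
    decide
  have hsum : ∑ p ∈ W, ∑ q ∈ W, (1 + sgn (p.1 ⬝ᵥ q.2) + sgn (p.2 ⬝ᵥ q.1) +
      sgn (p.1 ⬝ᵥ q.2 + p.2 ⬝ᵥ q.1)) = 0 :=
    Finset.sum_eq_zero fun p hp => Finset.sum_eq_zero fun q hq => hzero _ _ (hW p hp q hq)
  simp only [Finset.sum_add_distrib, Finset.sum_const, nsmul_eq_mul, mul_one] at hsum
  generalize ∑ p ∈ W, ∑ q ∈ W, sgn (p.1 ⬝ᵥ q.2) = T₁ at *
  generalize ∑ p ∈ W, ∑ q ∈ W, sgn (p.2 ⬝ᵥ q.1) = T₂ at *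
  generalize ∑ p ∈ W, ∑ q ∈ W, sgn (p.1 ⬝ᵥ q.2 + p.2 ⬝ᵥ q.1) = T₃ at *
  rcases Nat.eq_zero_or_pos W.card with h0 | hpos
  · simp [h0]
  have hpos' : (0 : ℤ) < (W.card : ℤ) ^ 2 := by positivity
  have hmain : (W.card : ℤ) ^ 2 * (W.card : ℤ) ^ 2 ≤ (W.card : ℤ) ^ 2 * (9 * 8 ^ k) := by
    have hW2 : (W.card : ℤ) ^ 2 = -(T₁ + T₂ + T₃) := by linarith
    calc (W.card : ℤ) ^ 2 * (W.card : ℤ) ^ 2 = (T₁ + T₂ + T₃) ^ 2 := by rw [hW2]; ring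
      _ ≤ 3 * (T₁ ^ 2 + T₂ ^ 2 + T₃ ^ 2) := by
          nlinarith [sq_nonneg (T₁ - T₂), sq_nonneg (T₁ - T₃), sq_nonneg (T₂ - T₃)]
      _ ≤ (W.card : ℤ) ^ 2 * (9 * 8 ^ k) := by linarith
  exact_mod_cast le_of_mul_le_mul_left hmain hpos'

/-! ### Pairs of vectors in two large subspaces -/

/-- Two subspaces `A` and `B` too large to be orthogonal contain `u₀` and `v₀` with inner product
`1`. Then, for every `(u, v)` in `A × B`, one of the four pairs `(u, v)`, `(u + u₀, v)`,
`(u, v + v₀)`, `(u + u₀, v + v₀)` has inner product `1`, because the four values add up to `1`; so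
at least a quarter of `A × B` consists of such pairs. -/
theorem card_mul_card_le_of_dotProduct {k : ℕ} (A B : Submodule (ZMod 2) (Fin k → ZMod 2))
    [DecidablePred (· ∈ A)] [DecidablePred (· ∈ B)]
    (h : 2 ^ k < (Finset.univ.filter (· ∈ A)).card * (Finset.univ.filter (· ∈ B)).card) :
    (Finset.univ.filter (· ∈ A)).card * (Finset.univ.filter (· ∈ B)).card ≤
      4 * (Finset.univ.filter fun p : (Fin k → ZMod 2) × (Fin k → ZMod 2) =>
        p.1 ∈ A ∧ p.2 ∈ B ∧ p.1 ⬝ᵥ p.2 = 1).card := by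
  classical
  set FA := Finset.univ.filter (· ∈ A) with hFA
  set FB := Finset.univ.filter (· ∈ B) with hFB
  obtain ⟨u₀, hu₀, v₀, hv₀, h₀⟩ : ∃ u ∈ A, ∃ v ∈ B, u ⬝ᵥ v ≠ 0 := by
    by_contra! hall
    have hsum := sq_sum_sgn_le FA FB dotRight 1 (fun v => by
      refine (Finset.card_le_card (t := {v}) fun w hw => ?_).trans_eq (Finset.card_singleton v)
      exact Finset.mem_singleton.2 (dotRight_injective (Finset.mem_filter.1 hw).2))
    have hone : ∑ x ∈ FA, ∑ y ∈ FB, sgn (dotRight y x) = FA.card * FB.card := by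
      rw [Finset.sum_congr rfl fun x hx => Finset.sum_congr rfl fun y hy => by
        rw [dotRight_apply, hall x (by simpa [hFA] using hx) y (by simpa [hFB] using hy),
          sgn, if_pos rfl]]
      simp
    rw [hone] at hsum
    have hsum' : (FA.card * FB.card) * (FA.card * FB.card) ≤ (FA.card * FB.card) * 2 ^ k := by
      have hX : Fintype.card (Fin k → ZMod 2) = 2 ^ k := by simp
      rw [hX] at hsum
      zify
      push_cast at hsum
      nlinarith
    exact absurd (Nat.le_of_mul_le_mul_left hsum' (Nat.zero_lt_of_lt h)) (not_le.2 h)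
  set Q := Finset.univ.filter fun p : (Fin k → ZMod 2) × (Fin k → ZMod 2) =>
    p.1 ∈ A ∧ p.2 ∈ B ∧ p.1 ⬝ᵥ p.2 = 1
  let shift : ((Fin k → ZMod 2) × (Fin k → ZMod 2)) → ((Fin k → ZMod 2) × (Fin k → ZMod 2)) :=
    fun p => if p.1 ⬝ᵥ p.2 = 1 then p else if (p.1 + u₀) ⬝ᵥ p.2 = 1 then (p.1 + u₀, p.2)
      else if p.1 ⬝ᵥ (p.2 + v₀) = 1 then (p.1, p.2 + v₀) else (p.1 + u₀, p.2 + v₀)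
  have hmaps : ∀ p ∈ FA ×ˢ FB, shift p ∈ Q := by
    intro p hp
    obtain ⟨hp1, hp2⟩ : p.1 ∈ A ∧ p.2 ∈ B := by simpa [hFA, hFB] using hp
    have key : ∀ a b c d : ZMod 2, d ≠ 0 → a ≠ 1 → a + b ≠ 1 → a + c ≠ 1 → a + c + (b + d) = 1 := by
      decide
    simp only [shift, Q, Finset.mem_filter, Finset.mem_univ, true_and]
    split_ifs with h1 h2 h3
    · exact ⟨hp1, hp2, h1⟩
    · exact ⟨A.add_mem hp1 hu₀, hp2, h2⟩
    · exact ⟨hp1, B.add_mem hp2 hv₀, h3⟩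
    · refine ⟨A.add_mem hp1 hu₀, B.add_mem hp2 hv₀, ?_⟩
      rw [add_dotProduct] at h2
      rw [dotProduct_add] at h3
      rw [add_dotProduct, dotProduct_add, dotProduct_add]
      exact key _ _ _ _ h₀ h1 h2 h3
  have hfib : ∀ q ∈ Q, ((FA ×ˢ FB).filter fun p => shift p = q).card ≤ 4 := by
    intro q _
    refine (Finset.card_le_card (t := {q, (q.1 - u₀, q.2), (q.1, q.2 - v₀), (q.1 - u₀, q.2 - v₀)})
      fun p hp => ?_).trans Finset.card_le_four
    have hq := (Finset.mem_filter.1 hp).2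
    simp only [shift] at hq
    simp only [Finset.mem_insert, Finset.mem_singleton]
    split_ifs at hq <;> subst hq <;> simp
  rw [← Finset.card_product]
  exact Finset.card_le_mul_card_image_of_maps_to hmaps 4 hfib

/-- `n` linear equations cut the binary space of dimension `k` down by a factor of at most
`2 ^ n`. -/
theorem two_pow_le_card_ker {k : ℕ} {ι : Type*} [Fintype ι] (g : ι → Fin k → ZMod 2)
    (A : Submodule (ZMod 2) (Fin k → ZMod 2)) [DecidablePred (· ∈ A)]
    (hA : ∀ x, (∀ t, x ⬝ᵥ g t = 0) → x ∈ A) :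
    2 ^ k ≤ 2 ^ Fintype.card ι * (Finset.univ.filter (· ∈ A)).card := by
  classical
  let f : (Fin k → ZMod 2) → ι → ZMod 2 := fun x t => x ⬝ᵥ g t
  have h := Finset.card_le_mul_card_image_of_maps_to (s := Finset.univ) (t := Finset.univ)
    (f := f) (fun _ _ => Finset.mem_univ _) (Finset.univ.filter (· ∈ A)).card (by
      intro y _
      rcases (Finset.univ.filter fun x => f x = y).eq_empty_or_nonempty with h0 | ⟨z, hz⟩
      · simp [h0]
      · refine Finset.card_le_card_of_injOn (fun x => x - z) (fun x hx => ?_)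
          fun x _ y _ hxy => sub_left_injective hxy
        simp only [Finset.coe_filter, Finset.mem_univ, true_and, Set.mem_ofPred_eq] at hx ⊢
        refine hA _ fun t => ?_
        have h1 := congr_fun hx t
        have h2 := congr_fun (Finset.mem_filter.1 hz).2 t
        simp only [f] at h1 h2
        rw [sub_dotProduct, h1, h2, sub_self])
  simpa [mul_comm] using h

/-! ### The complement of Peeters' graph -/

theorem exists_adj_compl_peetersGraph {k : ℕ} (hk : 2 ≤ k) (p : PeetersVertex k) :
    ∃ q, (peetersGraph k)ᶜ.Adj p q := by
  obtain ⟨⟨u, v⟩, huv⟩ := p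
  simp only at huv
  obtain ⟨w, hw, hwv⟩ : ∃ w : Fin k → ZMod 2, w ≠ 0 ∧ w ⬝ᵥ v = 0 := by
    let a : Fin k := ⟨0, by omega⟩
    let b : Fin k := ⟨1, by omega⟩
    have hab : a ≠ b := by simp [a, b]
    by_cases hv : v b = 0
    · exact ⟨Pi.single b 1, by simp, by simp [hv]⟩
    · refine ⟨Pi.single a (v b) - Pi.single b (v a), fun h => hv ?_, ?_⟩
      · simpa [hab] using congr_fun h a
      · simp [sub_dotProduct, mul_comm]
  refine ⟨⟨(u + w, v), by rw [add_dotProduct, hwv, add_zero, huv]⟩, ?_, fun h => ?_⟩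
  · simpa using hw
  · have h1 := h.1
    simp only [huv] at h1
    exact one_ne_zero h1

theorem minrk_compl_peetersGraph (k : ℕ) : minrk (peetersGraph k)ᶜ = k := by
  refine le_antisymm ?_ ?_
  · refine minrk_le_of_dotProduct _ (fun p => p.1.1) (fun p => p.1.2) (fun p => p.2) ?_
    intro p q hpq hadj
    by_contra h
    exact hadj ⟨hpq, fun h' => h h'.1⟩
  · refine le_minrk_of_pairwise_not_adj _
      (fun t => ⟨(Pi.single t 1, Pi.single t 1), by simp⟩) fun s t hst => ⟨fun h => ?_, fun h => ?_⟩
    · have h' := congr_fun (congr_arg (fun p : PeetersVertex k => p.1.1) h) s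
      simp [hst] at h'
    · exact h.2 ⟨by simp [hst], by simp [hst]⟩

theorem card_le_sqrt_of_eq_or_adj_compl {k : ℕ} (W : Finset (PeetersVertex k))
    (hW : ∀ p ∈ W, ∀ q ∈ W, p = q ∨ (peetersGraph k)ᶜ.Adj p q) :
    W.card ≤ Nat.sqrt (9 * 8 ^ k) := by
  classical
  have h := card_sq_le_of_independent (W.image Subtype.val) (by
    intro x hx y hy hxy
    obtain ⟨p, hp, rfl⟩ := Finset.mem_image.1 hx
    obtain ⟨q, hq, rfl⟩ := Finset.mem_image.1 hy
    rcases hW p hp q hq with rfl | hadj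
    · exact zero_ne_one (hxy.1.symm.trans p.2)
    · exact hadj.2 hxy)
  rw [Finset.card_image_of_injective _ Subtype.val_injective] at h
  exact Nat.le_sqrt'.2 h

/-- The counting argument behind the lower bound. The vertices orthogonal to the senders of more
than `L` bits have to be served by the other senders, whose colour classes are few, and are small
as they are independent in Peeters' graph. -/
theorem two_pow_le_of_taskBased {k : ℕ} {E : LinearSenders (peetersGraph k)ᶜ}
    (hE : E.IsTaskBasedIndexCode) (L : ℕ)
    (hb : 2 * (Finset.univ.filter fun j => L < E.len j).card < k) :
    2 ^ k ≤ 144 * E.length ^ 2 * 2 ^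
      (2 * L + 4 * (Finset.univ.filter fun j => L < E.len j).card) := by
  classical
  obtain ⟨c, hadj, hne, hc⟩ := hE.exists_colour
  set big := Finset.univ.filter fun j => L < E.len j with hbig
  set b := big.card
  let A : Submodule (ZMod 2) (Fin k → ZMod 2) :=
    ⨅ j ∈ big, LinearMap.ker (dotRight (j : PeetersVertex k).1.2)
  let B : Submodule (ZMod 2) (Fin k → ZMod 2) :=
    ⨅ j ∈ big, LinearMap.ker (dotRight (j : PeetersVertex k).1.1)
  have hmemA : ∀ x, x ∈ A ↔ ∀ j ∈ big, x ⬝ᵥ (j : PeetersVertex k).1.2 = 0 := by simp [A]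
  have hmemB : ∀ x, x ∈ B ↔ ∀ j ∈ big, x ⬝ᵥ (j : PeetersVertex k).1.1 = 0 := by simp [B]
  set FA := Finset.univ.filter (· ∈ A)
  set FB := Finset.univ.filter (· ∈ B)
  have hFA : 2 ^ k ≤ 2 ^ b * FA.card := by
    have h := two_pow_le_card_ker (fun j : big => (j.1 : PeetersVertex k).1.2) A fun x hx =>
      (hmemA x).2 fun j hj => hx ⟨j, hj⟩
    rwa [Fintype.card_coe] at h
  have hFB : 2 ^ k ≤ 2 ^ b * FB.card := by
    have h := two_pow_le_card_ker (fun j : big => (j.1 : PeetersVertex k).1.1) B fun x hx =>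
      (hmemB x).2 fun j hj => hx ⟨j, hj⟩
    rwa [Fintype.card_coe] at h
  have hAB : 2 ^ k * 2 ^ k ≤ 2 ^ (2 * b) * (FA.card * FB.card) := by
    calc 2 ^ k * 2 ^ k ≤ (2 ^ b * FA.card) * (2 ^ b * FB.card) := Nat.mul_le_mul hFA hFB
      _ = 2 ^ (2 * b) * (FA.card * FB.card) := by ring
  have hlarge : 2 ^ k < FA.card * FB.card := by
    by_contra! h
    have h1 : 2 ^ k * 2 ^ k ≤ 2 ^ (2 * b) * 2 ^ k := hAB.trans (Nat.mul_le_mul_left _ h)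
    have h2 := Nat.le_of_mul_le_mul_right h1 (by positivity)
    exact absurd ((Nat.pow_le_pow_iff_right (by norm_num)).1 h2) (by omega)
  have hQ := card_mul_card_le_of_dotProduct A B hlarge
  set Q := Finset.univ.filter fun p : (Fin k → ZMod 2) × (Fin k → ZMod 2) =>
    p.1 ∈ A ∧ p.2 ∈ B ∧ p.1 ⬝ᵥ p.2 = 1
  let QV := Finset.univ.filter fun p : PeetersVertex k => p.1.1 ∈ A ∧ p.1.2 ∈ B
  have hQV : Q.card ≤ QV.card := by
    refine (Finset.card_le_card fun p hp => ?_).trans (Finset.card_image_le (f := Subtype.val))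
    have hp' := (Finset.mem_filter.1 hp).2
    exact Finset.mem_image.2 ⟨⟨p, hp'.2.2⟩, by simp [QV, hp'.1, hp'.2.1], rfl⟩
  let colours : Finset (Σ j : E.S, (Fin (E.len j) → ZMod 2)) :=
    (Finset.univ.filter fun j => ¬ L < E.len j).sigma fun j => Finset.univ.erase 0
  have hcolours : colours.card ≤ E.length * 2 ^ L := by
    rw [Finset.card_sigma, LinearSenders.length, Finset.sum_mul]
    refine (Finset.sum_le_sum fun j hj => ?_).trans
      (Finset.sum_le_sum_of_subset (Finset.filter_subset _ _))
    have hj' : E.len j ≤ L := not_lt.1 (Finset.mem_filter.1 hj).2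
    rw [Finset.card_erase_of_mem (Finset.mem_univ _), Finset.card_univ, Fintype.card_fun,
      ZMod.card, Fintype.card_fin]
    -- a sender of length `0` contributes no colour, as the zero functional is excluded
    rcases Nat.eq_zero_or_pos (E.len j) with h0 | hpos
    · simp [h0]
    · calc 2 ^ E.len j - 1 ≤ 2 ^ L :=
            (Nat.sub_le _ _).trans (Nat.pow_le_pow_right (by norm_num) hj')
        _ ≤ E.len j * 2 ^ L := Nat.le_mul_of_pos_left _ hpos
  have hmaps : ∀ p ∈ QV, c p ∈ colours := by
    intro p hp
    have hp' := (Finset.mem_filter.1 hp).2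
    simp only [colours, Finset.mem_sigma, Finset.mem_filter, Finset.mem_univ, true_and,
      Finset.mem_erase, and_true]
    refine ⟨fun hlt => (hadj p).2 ?_, hne p⟩
    have hj : (c p).1 ∈ big := by simp [hbig, hlt]
    refine ⟨?_, ?_⟩
    · rw [dotProduct_comm]
      exact (hmemB _).1 hp'.2 _ hj
    · rw [dotProduct_comm]
      exact (hmemA _).1 hp'.1 _ hj
  have hclass : ∀ col ∈ colours, (QV.filter fun p => c p = col).card ≤ Nat.sqrt (9 * 8 ^ k) := by
    intro col _
    refine card_le_sqrt_of_eq_or_adj_compl _ fun p hp q hq => hc p q ?_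
    exact (Finset.mem_filter.1 hp).2.trans (Finset.mem_filter.1 hq).2.symm
  have hcount : QV.card ≤ Nat.sqrt (9 * 8 ^ k) * (E.length * 2 ^ L) :=
    (Finset.card_le_mul_card_image_of_maps_to hmaps _ hclass).trans
      (Nat.mul_le_mul_left _ hcolours)
  have htotal : 2 ^ k * 2 ^ k ≤
      2 ^ (2 * b) * (4 * (Nat.sqrt (9 * 8 ^ k) * (E.length * 2 ^ L))) :=
    hAB.trans (Nat.mul_le_mul_left _ (hQ.trans (Nat.mul_le_mul_left _ (hQV.trans hcount))))
  refine Nat.le_of_mul_le_mul_left (c := 8 ^ k) ?_ (by positivity)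
  have h8 : 8 ^ k * 2 ^ k = (2 ^ k * 2 ^ k) ^ 2 := by
    rw [show 8 = 2 * 2 * 2 by norm_num, mul_pow, mul_pow]
    ring
  calc 8 ^ k * 2 ^ k = (2 ^ k * 2 ^ k) ^ 2 := h8
    _ ≤ (2 ^ (2 * b) * (4 * (Nat.sqrt (9 * 8 ^ k) * (E.length * 2 ^ L)))) ^ 2 :=
        Nat.pow_le_pow_left htotal 2
    _ = Nat.sqrt (9 * 8 ^ k) ^ 2 * (16 * E.length ^ 2 * 2 ^ (2 * L + 4 * b)) := by ring
    _ ≤ (9 * 8 ^ k) * (16 * E.length ^ 2 * 2 ^ (2 * L + 4 * b)) :=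
        Nat.mul_le_mul_right _ (Nat.sqrt_le' _)
    _ = 8 ^ k * (144 * E.length ^ 2 * 2 ^ (2 * L + 4 * b)) := by ring

theorem pow_four_le_mul_two_pow (h : ℕ) : h ^ 4 ≤ 21 * 2 ^ h := by
  rcases Nat.lt_or_ge h 6 with hlt | hge
  · interval_cases h <;> norm_num
  · induction h, hge using Nat.le_induction with
    | base => norm_num
    | succ n hn ih =>
      have h1 : (n + 1) ^ 4 ≤ 2 * n ^ 4 := by
        obtain ⟨m, rfl⟩ := Nat.exists_eq_add_of_le hn
        ring_nf
        nlinarith [Nat.zero_le (m ^ 4), Nat.zero_le (m ^ 3), Nat.zero_le (m ^ 2)]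
      calc (n + 1) ^ 4 ≤ 2 * n ^ 4 := h1
        _ ≤ 2 * (21 * 2 ^ n) := Nat.mul_le_mul_left _ ih
        _ = 21 * 2 ^ (n + 1) := by ring

/-- Senders of more than `k / 8` bits number less than `k / 16` unless the code is already of
quadratic length, and then the other senders cannot serve the rest of the graph with fewer than
exponentially many bits. -/
theorem sq_le_length_of_taskBased {k : ℕ} {E : LinearSenders (peetersGraph k)ᶜ}
    (hE : E.IsTaskBasedIndexCode) : k ^ 2 ≤ 220 * E.length := by
  by_contra! hlt
  have hcount := two_pow_le_of_taskBased hE (k / 8)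
  set b := (Finset.univ.filter fun j => k / 8 < E.len j).card with hb
  have hbig : b * (k / 8 + 1) ≤ E.length := by
    calc b * (k / 8 + 1) = ∑ j ∈ Finset.univ.filter (fun j => k / 8 < E.len j), (k / 8 + 1) := by
          rw [Finset.sum_const, smul_eq_mul]
      _ ≤ ∑ j ∈ Finset.univ.filter (fun j => k / 8 < E.len j), E.len j :=
          Finset.sum_le_sum fun j hj => (Finset.mem_filter.1 hj).2
      _ ≤ E.length := Finset.sum_le_sum_of_subset (Finset.filter_subset _ _)
  have hbk : 16 * b < k := by
    have h8 : k ≤ 8 * (k / 8 + 1) := by omega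
    have h1 : b * k ≤ b * (8 * (k / 8 + 1)) := Nat.mul_le_mul_left _ h8
    by_contra! hge
    have h2 : k * k ≤ 16 * b * k := Nat.mul_le_mul_right _ hge
    nlinarith
  have hpow := hcount (by omega)
  obtain ⟨h, hh⟩ : ∃ h, k = h + (2 * (k / 8) + 4 * b) :=
    ⟨k - (2 * (k / 8) + 4 * b), by omega⟩
  have hhalf : k ≤ 2 * h := by omega
  have hh2 : 2 ^ h ≤ 144 * E.length ^ 2 := by
    refine Nat.le_of_mul_le_mul_right (c := 2 ^ (2 * (k / 8) + 4 * b)) ?_ (Nat.two_pow_pos _)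
    rwa [← pow_add, ← hh]
  have hk4 : (k ^ 2) ^ 2 ≤ (220 * E.length) ^ 2 := by
    calc (k ^ 2) ^ 2 = k ^ 4 := by ring
      _ ≤ (2 * h) ^ 4 := Nat.pow_le_pow_left hhalf 4
      _ = 16 * h ^ 4 := by ring
      _ ≤ 16 * (21 * (144 * E.length ^ 2)) :=
          Nat.mul_le_mul_left _ ((pow_four_le_mul_two_pow h).trans (Nat.mul_le_mul_left _ hh2))
      _ ≤ (220 * E.length) ^ 2 := by ring_nf; omega
  exact absurd (lt_of_pow_lt_pow_left₀ 2 (Nat.zero_le _) (hk4.trans_lt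
    (Nat.pow_lt_pow_left hlt two_ne_zero))) (lt_irrefl _)

theorem sq_le_tb_compl_peetersGraph {k : ℕ} (hk : 2 ≤ k) :
    k ^ 2 ≤ 220 * tb (peetersGraph k)ᶜ := by
  obtain ⟨E, hE, hl⟩ := Nat.sInf_mem
    (taskBasedLengths_nonempty _ (exists_adj_compl_peetersGraph hk))
  exact (sq_le_length_of_taskBased hE).trans_eq (congr_arg (220 * ·) hl)

/-- The complement of Peeters' graph for `k = 1` is an isolated vertex, for which no code exists, so
a single edge takes its place; for `k = 0` the graph without vertices serves. -/
theorem exists_graph_of_le_one {k : ℕ} (hk : k ≤ 1) :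
    ∃ (V : Type) (_ : Fintype V) (G : SimpleGraph V), (∀ v, ∃ w, G.Adj v w) ∧ minrk G = k := by
  interval_cases k
  · exact ⟨Fin 0, inferInstance, ⊥, fun v => v.elim0, Nat.le_zero.1
      (minrk_le_of_dotProduct _ (fun v => v.elim0) (fun v => v.elim0) (fun v => v.elim0)
        fun v => v.elim0)⟩
  · refine ⟨Fin 2, inferInstance, ⊤, by decide, le_antisymm ?_ ?_⟩
    · exact minrk_le_of_dotProduct _ (fun _ _ => 1) (fun _ _ => 1) (by decide)
        fun i j hij h => absurd hij h
    · exact le_minrk_of_pairwise_not_adj _ (fun _ => 0) fun s t hst =>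
        absurd (Subsingleton.elim s t) hst

theorem exists_graph_minrk_eq (k : ℕ) :
    ∃ (V : Type) (_ : Fintype V) (G : SimpleGraph V),
      (2 ≤ k → Nonempty (G ≃g (peetersGraph k)ᶜ)) ∧ (∀ v, ∃ w, G.Adj v w) ∧
        minrk G = k ∧ k ^ 2 ≤ 220 * tb G := by
  rcases Nat.lt_or_ge k 2 with hk | hk
  · obtain ⟨V, inst, G, hG, hr⟩ := exists_graph_of_le_one (Nat.lt_succ_iff.1 hk)
    refine ⟨V, inst, G, fun h => absurd h (not_le.2 hk), hG, hr, ?_⟩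
    have h : k ≤ tb G := hr ▸ (minrk_le_emb G ⟨_, exists_embedded_length_eq G hG⟩).trans
      (emb_le_tb G (taskBasedLengths_nonempty G hG))
    nlinarith
  · exact ⟨_, inferInstance, (peetersGraph k)ᶜ, fun _ => ⟨RelIso.refl _⟩,
      exists_adj_compl_peetersGraph hk, minrk_compl_peetersGraph k, sq_le_tb_compl_peetersGraph hk⟩

end IndexCoding

theorem theorem1 :
    ∃ c C : ℝ, 0 < c ∧ 0 < C ∧
      (∀ k : ℕ, ∃ (V : Type) (_ : Fintype V) (G : SimpleGraph V),
        (2 ≤ k → Nonempty (G ≃g (IndexCoding.peetersGraph k)ᶜ)) ∧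
        IndexCoding.minrk G = k ∧
        (IndexCoding.taskBasedLengths G).Nonempty ∧
        c * (k : ℝ) ^ 2 ≤ (IndexCoding.tb G : ℝ) ∧
        (IndexCoding.tb G : ℝ) ≤ C * (k : ℝ) ^ 2 ∧
        (IndexCoding.embeddedLengths G).Nonempty ∧
        IndexCoding.emb G ≤ 2 * k ∧
        c * (IndexCoding.emb G : ℝ) ^ 2 ≤ (IndexCoding.tb G : ℝ)) ∧
      (∀ (V : Type) [Fintype V] (G : SimpleGraph V), (∀ v, ∃ w, G.Adj v w) →
        (IndexCoding.taskBasedLengths G).Nonempty ∧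
        (IndexCoding.tb G : ℝ) ≤ C * (IndexCoding.minrk G : ℝ) ^ 2 ∧
        (IndexCoding.embeddedLengths G).Nonempty ∧
        (IndexCoding.tb G : ℝ) ≤ C * (IndexCoding.emb G : ℝ) ^ 2) := by
  refine ⟨1 / 880, 2, by norm_num, by norm_num, fun k => ?_, fun V _ G hG => ?_⟩
  · obtain ⟨V, inst, G, hiso, hG, hr, hlow⟩ := IndexCoding.exists_graph_minrk_eq k
    have hup := IndexCoding.tb_le_two_mul_minrk_sq G hG
    have hemb := IndexCoding.emb_le_two_mul_minrk G hG
    rw [hr] at hup hemb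
    have hlow' : (k : ℝ) ^ 2 ≤ 220 * IndexCoding.tb G := by exact_mod_cast hlow
    have hemb' : (IndexCoding.emb G : ℝ) ≤ 2 * k := by exact_mod_cast hemb
    have hemb2 : (IndexCoding.emb G : ℝ) ^ 2 ≤ (2 * k) ^ 2 :=
      pow_le_pow_left₀ (Nat.cast_nonneg _) hemb' 2
    refine ⟨V, inst, G, hiso, hr, IndexCoding.taskBasedLengths_nonempty G hG, ?_,
      by exact_mod_cast hup, ⟨_, IndexCoding.exists_embedded_length_eq G hG⟩, hemb, ?_⟩
    · nlinarith [sq_nonneg (k : ℝ)]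
    · nlinarith
  · have hne : (IndexCoding.embeddedLengths G).Nonempty :=
      ⟨_, IndexCoding.exists_embedded_length_eq G hG⟩
    have hup := IndexCoding.tb_le_two_mul_minrk_sq G hG
    refine ⟨IndexCoding.taskBasedLengths_nonempty G hG, by exact_mod_cast hup, hne, ?_⟩
    have h : IndexCoding.tb G ≤ 2 * IndexCoding.emb G ^ 2 := hup.trans
      (Nat.mul_le_mul_left _ (Nat.pow_le_pow_left (IndexCoding.minrk_le_emb G hne) 2))
    exact_mod_cast h
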